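/- **Diagrams.** A *diagram* is a pair $\Gamma=(N,B)$ with $N$ a finite set and $B=(B_{ij})_{i,j\in N}$ a symmetric matrix of integers whose diagonal entries $B_{ii}$ are even. Given $r=(r_i)\in\mathbb Z_{\ge 1}^N$, the *rescaled diagram* of $(\Gamma,r)$ is $(N,\widetilde B)$, where $$\widetilde B_{ij}=\frac{B_{ij}}{r_ir_j}\quad(i\ne j),\qquad \widetilde B_{ii}=\frac{B_{ii}-1}{r_i^2}.$$ **Stokes circles.** An exponential factor is a finite sum $q=\sum_{k\in\mathbb Q_{>0}}a_kz^k$ with $a_k\in\mathbb C$; its exponents are the $k$ with $a_k\neq0$. A *Stokes circle* (at $z=\infty$) is an orbit $\langle q\rangle$ of exponential factors under $z^k\mapsto e^{2\pi i nk}z^k$, $n\in\mathbb Z$. The ramification order $\mathrm{Ram}(q)$ is the least integer $r\ge1$ such that $q$ is a polynomial in $z^{1/r}$, and $\mathrm{Slope}(q)$ is the largest exponent of $q$ (and $0$ if $q=0$). An algebraic connection $(E,\nabla)$ on the affine line $\mathbb A^1(\mathbb C)$ (a vector bundle with connection) has an *irregular class* $\Theta=\sum_I n_I I$ at $\infty$: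 if $G z^{\Lambda}e^{Q}$ is a formal fundamental matrix of horizontal sections at $\infty$, where $G$ is an invertible matrix over $\mathbb C((z^{-1/m}))$ for some $m\ge1$, $Q=\mathrm{diag}(q_1,\dots,q_n)$ with exponential factors $q_j\in\mathbb C[z^{1/m}]$, and $\Lambda$ is a constant matrix commuting with $Q$, then $n_{\langle q\rangle}=\#\{j: q_j=q\}$. **Multiplicities.** For a finite set $S=\{k_0>\dots>k_p\}$ of positive rationals in $\frac1r\mathbb Z\cap\frac1{r'}\mathbb Z$, written $k_j=m_j/r=m_j'/r'$, put $$g_{r'}(S)=\gcd(r',m_0',\dots,m_p')\quad(g_{r'}(\emptyset)=r'),$$ $$\sigma_{r,r'}(S)=m_0\bigl(r'-\gcd(r',m_0')\bigr)+\sum_{j=1}^p m_j\bigl(\gcd(r',m_0',\dots,m_{j-1}')-\gcd(r',m_0',\dots,m_j')\bigr)\quad(\sigma_{r,r'}(\emptyset)=0).$$ The loop multiplicity of $I=\langle q\rangle$, with $r=\mathrm{Ram}(q)$ and $S$ the set of exponents of $q$, is $$B_{I,I}=\sigma_{r,r}(S)-r^2+1.$$ Let $I=\langle q\rangle\neq J=\langle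 q'\rangle$, $r=\mathrm{Ram}(q)$, $r'=\mathrm{Ram}(q')$. Let $\tau_k(q)$ be $q$ with all monomials of exponent $<k$ removed, let $k$ be the least element of $\frac1{\mathrm{lcm}(r,r')}\mathbb Z_{>0}$ with $\langle\tau_k(q)\rangle=\langle\tau_k(q')\rangle$, let $S_c$ be the set of exponents of $\tau_k(q)$ (equivalently of $\tau_k(q')$), and put $q_d=q-\tau_k(q)$, $q_d'=q'-\tau_k(q')$. If $\mathrm{Slope}(q_d)\ge\mathrm{Slope}(q_d')$ (otherwise exchange $I$ and $J$), write $\mathrm{Slope}(q_d)=s_d/r$; the edge multiplicity of $I$ and $J$ is $$B_{I,J}=B_{J,I}=\sigma_{r,r'}(S_c)+s_d\,g_{r'}(S_c)-rr'.$$ **Nonabelian Hodge diagrams.** A diagram $(N,B)$ is a *nonabelian Hodge diagram* if there is an algebraic connection on the affine line, with irregular class $\Theta$ at $\infty$, and a bijection $i\mapsto I_i$ from $N$ onto the set of distinct Stokes circles of $\Theta$, such that $B_{ii}=B_{I_i,I_i}$ for all $i$ and $B_{ij}=B_{I_i,I_j}$ for all $i\neq j$. **Corollary 1.9.** Let $\Gamma=(N,B)$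 be a nonabelian Hodge diagram. Then there exists $r\in\mathbb Z_{\ge1}^N$ such that the rescaled diagram $(N,\widetilde B)$ of $(\Gamma,r)$ satisfies both of the following conditions: 1. for all pairwise distinct $i,j,k\in N$, if $\widetilde B_{ij}\le\widetilde B_{ik}\le\widetilde B_{jk}$, then $\widetilde B_{ik}=\widetilde B_{jk}$; 2. for all $i,j\in N$ with $i\ne j$, $\widetilde B_{ii}\le\widetilde B_{ij}$. -/

import Mathlib

open Polynomial

noncomputable section

namespace NonabelianHodge

/-! ### Diagrams, decorations, rescaling -/

/-- A diagram on the vertex set `N` (which is finite in all uses): a symmetric matrix with integer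
entries and even diagonal. `B i j` is the (possibly negative) number of edges between `i ≠ j`, and
`B i i / 2` is the (possibly negative) number of loops at `i`. -/
structure Diagram (N : Type*) where
  B : Matrix N N ℤ
  symm : ∀ i j, B i j = B j i
  even_diag : ∀ i, Even (B i i)

open Classical in
/-- The matrix of the rescaled diagram attached to a diagram and a decoration `r ∈ ℤ_{≥1}^N`. -/
def Diagram.rescaled {N : Type*} (Γ : Diagram N) (r : N → ℕ+) : Matrix N N ℚ := fun i j =>
  if i = j then ((Γ.B i i : ℚ) - 1) / ((r i : ℕ) : ℚ) ^ 2
  else (Γ.B i j : ℚ) / (((r i : ℕ) : ℚ) * ((r j : ℕ) : ℚ))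

/-- The ultrametric condition on the off-diagonal entries. -/
def UltrametricEdges {N : Type*} (C : Matrix N N ℚ) : Prop :=
  ∀ i j k : N, i ≠ j → i ≠ k → j ≠ k → C i j ≤ C i k → C i k ≤ C j k → C i k = C j k

/-- The inequality between loops and adjacent edges. -/
def LoopEdgeInequality {N : Type*} (C : Matrix N N ℚ) : Prop :=
  ∀ i j : N, i ≠ j → C i i ≤ C i j

/-! ### Exponential factors and Stokes circles at infinity -/

/-- An exponential factor at infinity: a Puiseux polynomial `q = ∑ a_k z ^ k`, the sum being over
finitely many rational numbers `k > 0`. It is stored as the function `k ↦ a_k`. -/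
abbrev ExpFactor := {k : ℚ // 0 < k} →₀ ℂ

/-- `q'` is obtained from `q` by analytic continuation along `n` turns around infinity, i.e. by
`z ^ k ↦ exp (2 π i n k) z ^ k`, for some `n ∈ ℤ`: they are in the same Galois orbit. -/
def GaloisConj (q q' : ExpFactor) : Prop :=
  ∃ n : ℤ, ∀ k : {k : ℚ // 0 < k},
    q' k = Complex.exp (2 * Real.pi * Complex.I * (n * ((k : ℚ) : ℂ))) * q k

theorem GaloisConj.refl (q : ExpFactor) : GaloisConj q q := ⟨0, by simp⟩

theorem GaloisConj.symm {q q' : ExpFactor} (h : GaloisConj q q') : GaloisConj q' q := by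
  obtain ⟨n, hn⟩ := h
  refine ⟨-n, fun k => ?_⟩
  rw [hn k, ← mul_assoc, ← Complex.exp_add]
  push_cast
  ring_nf
  simp

theorem GaloisConj.trans {q q' q'' : ExpFactor} (h : GaloisConj q q') (h' : GaloisConj q' q'') :
    GaloisConj q q'' := by
  obtain ⟨n, hn⟩ := h
  obtain ⟨n', hn'⟩ := h'
  refine ⟨n' + n, fun k => ?_⟩
  rw [hn' k, hn k, ← mul_assoc, ← Complex.exp_add]
  push_cast
  ring_nf

/-- The equivalence relation whose classes are the Galois orbits. -/
instance galoisSetoid : Setoid ExpFactor where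
  r := GaloisConj
  iseqv := ⟨GaloisConj.refl, GaloisConj.symm, GaloisConj.trans⟩

/-- A Stokes circle at infinity: a Galois orbit `⟨q⟩` of exponential factors. -/
abbrev StokesCircle := Quotient galoisSetoid

theorem GaloisConj.support_eq {q q' : ExpFactor} (h : GaloisConj q q') :
    q'.support = q.support := by
  obtain ⟨n, hn⟩ := h
  ext k
  simp [hn k, Complex.exp_ne_zero]

/-- The ramification order: the smallest `r ≥ 1` such that `q` is a polynomial in `z ^ (1 / r)`,
that is, the least common multiple of the denominators of the exponents. It is `1` for `q = 0`. -/
def ram (q : ExpFactor) : ℕ := q.support.lcm fun k => (k : ℚ).den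

/-- The slope: the largest exponent, and `0` for `q = 0`. -/
def slope (q : ExpFactor) : ℚ≥0 := q.support.sup fun k => ⟨(k : ℚ), k.2.le⟩

/-- The numerator of `k` when it is written with denominator `r`, i.e. the integer `m` with
`k = m / r` (used only if `r * k` is an integer and `k ≥ 0`). -/
def numer (r : ℕ) (k : ℚ) : ℕ := (k * r).num.toNat

/-- For a finite set `S` of exponents, the integer `gcd (r, m_0, …, m_p)`, where the elements of
`S` are `m_0 / r, …, m_p / r`. For empty `S` this is `r`. -/
def gcdWith (r : ℕ) (S : Finset {k : ℚ // 0 < k}) : ℕ := Nat.gcd r (S.gcd fun k => numer r k)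

/-- For a finite set `S = {k_0 > ⋯ > k_p}` of exponents, with `k_j = m_j / r = m'_j / r'`, the sum
`∑ j, m_j (gcd (r', m'_0, …, m'_{j-1}) - gcd (r', m'_0, …, m'_j))`; the term for `j = 0` is
`m_0 (r' - gcd (r', m'_0))`. -/
def levelSum (r r' : ℕ) (S : Finset {k : ℚ // 0 < k}) : ℤ :=
  ∑ k ∈ S, (numer r k : ℤ) *
    ((gcdWith r' (S.filter fun l => k < l) : ℤ) - (gcdWith r' (S.filter fun l => k ≤ l) : ℤ))

/-- The loop multiplicity `B_{I,I}` of `I = ⟨q⟩`, computed from the representative `q`. -/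
def loopMultAux (q : ExpFactor) : ℤ := levelSum (ram q) (ram q) q.support - (ram q : ℤ) ^ 2 + 1

/-- The truncation `τ_k q`: remove all the monomials of exponent `< k`. -/
def trunc (k : ℚ) (q : ExpFactor) : ExpFactor := q.filter fun l => k ≤ (l : ℚ)

/-- The smallest `k ∈ (1 / lcm (r, r')) ℤ_{>0}` such that `⟨τ_k q⟩ = ⟨τ_k q'⟩`. -/
def cutoff (q q' : ExpFactor) : ℚ :=
  (sInf {n : ℕ | 0 < n ∧
      GaloisConj (trunc ((n : ℚ) / (Nat.lcm (ram q) (ram q') : ℕ)) q)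
        (trunc ((n : ℚ) / (Nat.lcm (ram q) (ram q') : ℕ)) q')} : ℕ) /
    (Nat.lcm (ram q) (ram q') : ℕ)

/-- The common part `q_c` of `q` with respect to `q'`. -/
def commonPart (q q' : ExpFactor) : ExpFactor := trunc (cutoff q q') q

/-- The different part `q_d = q - q_c` of `q` with respect to `q'`. -/
def diffPart (q q' : ExpFactor) : ExpFactor := q - commonPart q q'

/-- The formula for the edge multiplicity of `⟨q⟩` and `⟨q'⟩`
when `slope q_d ≥ slope q'_d`, so that `slope q_d = s_d / r` is the fission exponent. -/
def edgeFormula (q q' : ExpFactor) : ℤ :=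
  levelSum (ram q) (ram q') (commonPart q q').support
    + (numer (ram q) (slope (diffPart q q') : ℚ) : ℤ) *
        (gcdWith (ram q') (commonPart q q').support : ℤ)
    - (ram q : ℤ) * (ram q' : ℤ)

/-- The edge multiplicity `B_{I,J}` of `I = ⟨q⟩ ≠ J = ⟨q'⟩`, computed from `q` and `q'`. -/
def edgeMultAux (q q' : ExpFactor) : ℤ :=
  if slope (diffPart q' q) ≤ slope (diffPart q q') then edgeFormula q q' else edgeFormula q' q

/-! The multiplicities do not depend on the representatives. -/

theorem ram_congr {q q' : ExpFactor} (h : GaloisConj q q') : ram q = ram q' := by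
  simp only [ram, h.support_eq]

theorem loopMultAux_congr {q q' : ExpFactor} (h : GaloisConj q q') :
    loopMultAux q = loopMultAux q' := by
  simp only [loopMultAux, ram_congr h, h.support_eq]

theorem GaloisConj.trunc {q q' : ExpFactor} (h : GaloisConj q q') (k : ℚ) :
    GaloisConj (trunc k q) (trunc k q') := by
  obtain ⟨n, hn⟩ := h
  refine ⟨n, fun l => ?_⟩
  by_cases hl : k ≤ (l : ℚ) <;> simp [NonabelianHodge.trunc, hl, hn l]

theorem cutoff_congr {p p' q q' : ExpFactor} (h : GaloisConj p p') (h' : GaloisConj q q') :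
    cutoff p q = cutoff p' q' := by
  have key : ∀ k : ℚ, GaloisConj (trunc k p) (trunc k q) ↔
      GaloisConj (trunc k p') (trunc k q') := fun k =>
    ⟨fun H => ((h.trunc k).symm.trans H).trans (h'.trunc k),
      fun H => ((h.trunc k).trans H).trans (h'.trunc k).symm⟩
  simp only [cutoff, ram_congr h, ram_congr h', key]

theorem commonPart_congr {p p' q q' : ExpFactor} (h : GaloisConj p p') (h' : GaloisConj q q') :
    GaloisConj (commonPart p q) (commonPart p' q') := by
  simp only [commonPart, cutoff_congr h h']
  exact h.trunc _

theorem diffPart_congr {p p' q q' : ExpFactor} (h : GaloisConj p p') (h' : GaloisConj q q') :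
    GaloisConj (diffPart p q) (diffPart p' q') := by
  simp only [diffPart, commonPart, cutoff_congr h h']
  obtain ⟨n, hn⟩ := h
  refine ⟨n, fun l => ?_⟩
  by_cases hl : cutoff p' q' ≤ (l : ℚ) <;> simp [trunc, hl, hn l]

theorem edgeFormula_congr {p p' q q' : ExpFactor} (h : GaloisConj p p') (h' : GaloisConj q q') :
    edgeFormula p q = edgeFormula p' q' := by
  simp only [edgeFormula, slope, ram_congr h, ram_congr h', (commonPart_congr h h').support_eq,
    (diffPart_congr h h').support_eq]

theorem edgeMultAux_congr {p p' q q' : ExpFactor} (h : GaloisConj p p') (h' : GaloisConj q q') :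
    edgeMultAux p q = edgeMultAux p' q' := by
  simp only [edgeMultAux, slope, edgeFormula_congr h h', edgeFormula_congr h' h,
    (diffPart_congr h h').support_eq, (diffPart_congr h' h).support_eq]

/-- The loop multiplicity `B_{I,I}` of a Stokes circle. -/
def loopMult (I : StokesCircle) : ℤ := Quotient.lift loopMultAux (fun _ _ h => loopMultAux_congr h) I

/-- The edge multiplicity `B_{I,J}` of two distinct Stokes circles. -/
def edgeMult (I J : StokesCircle) : ℤ :=
  Quotient.lift₂ edgeMultAux (fun _ _ _ _ h h' => edgeMultAux_congr h h') I J

/-! ### Irregular classes and their core diagrams -/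

/-- An irregular class at infinity `Θ = ∑ n_i I_i`: a finite multiset of Stokes circles. The
distinct Stokes circles of `Θ` are the elements of `Θ.support`. -/
abbrev IrregularClass := StokesCircle →₀ ℕ

/-- `Γ` is the core diagram `Γ_c(Θ)`, its vertices being identified with the distinct Stokes
circles of `Θ` by some bijection. -/
def IsCoreDiagram {N : Type*} (Γ : Diagram N) (Θ : IrregularClass) : Prop :=
  ∃ I : N ≃ Θ.support,
    (∀ i, Γ.B i i = loopMult (I i)) ∧ ∀ i j, i ≠ j → Γ.B i j = edgeMult (I i) (I j)

/-! ### Algebraic connections on the affine line -/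

/-- An algebraic connection on the affine line `Spec ℂ[z]`: a vector bundle, given by its module
`E` of global sections, a finitely generated projective `ℂ[z]`-module, with a connection
`s ↦ nabla s ⊗ dz`. -/
structure AlgebraicConnection where
  E : Type
  [addCommGroup : AddCommGroup E]
  [module : Module ℂ[X] E]
  [finite : Module.Finite ℂ[X] E]
  [projective : Module.Projective ℂ[X] E]
  nabla : E →+ E
  leibniz : ∀ (f : ℂ[X]) (s : E), nabla (f • s) = derivative f • s + f • nabla s

attribute [instance] AlgebraicConnection.addCommGroup AlgebraicConnection.module
  AlgebraicConnection.finite AlgebraicConnection.projective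

/-- Expansion at infinity `ℂ[z] → ℂ((t))`, `z ↦ t ^ (-m)`, where `t = z ^ (-1 / m)`. -/
def expandAtInfinity (m : ℕ) : ℂ[X] →ₐ[ℂ] LaurentSeries ℂ :=
  Polynomial.aeval (HahnSeries.single (-(m : ℤ)) (1 : ℂ))

/-- The derivation `z d/dz = -(1 / m) t d/dt` of `ℂ((t))`, where `t = z ^ (-1 / m)`. -/
def eulerDeriv (m : ℕ) (f : LaurentSeries ℂ) : LaurentSeries ℂ :=
  (-(m : ℂ)⁻¹) • (HahnSeries.single (1 : ℤ) (1 : ℂ) * LaurentSeries.derivative ℂ f)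

/-- The element of `ℂ((t))`, `t = z ^ (-1 / m)`, given by the exponential factor `q`, when `m` is
a multiple of the ramification order of `q`: the monomial `z ^ k` becomes `t ^ (-m k)`. -/
def ExpFactor.toLaurent (m : ℕ) (q : ExpFactor) : LaurentSeries ℂ :=
  q.sum fun k a => HahnSeries.single (-((m : ℚ) * (k : ℚ)).num) a

/-- `Θ` is the irregular class at infinity of the connection. In a basis of `E`, with connection
matrix `A` (so the horizontal sections satisfy `dv/dz = -A v`), there is a formal
fundamental matrix of horizontal sections `G z ^ Λ exp (Q)`, where `G` is invertible with entries
in `ℂ((t))`, `t = z ^ (-1 / m)`, `Q` is the diagonal matrix of exponential factors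
`q_1, …, q_n`, polynomials in `z ^ (1 / m)`, and `Λ` is a constant matrix commuting with `Q`.
The multiplicity in `Θ` of a Stokes circle `⟨p⟩` is the number of `j` with `q_j = p`. -/
def AlgebraicConnection.HasIrregularClass (C : AlgebraicConnection) (Θ : IrregularClass) : Prop :=
  ∃ (n : ℕ) (b : Module.Basis (Fin n) ℂ[X] C.E) (m : ℕ) (G : GL (Fin n) (LaurentSeries ℂ))
    (q : Fin n → ExpFactor) (Λ : Matrix (Fin n) (Fin n) ℂ),
    0 < m ∧
    (∀ j, ram (q j) ∣ m) ∧
    (∀ i j, Λ i j ≠ 0 → q i = q j) ∧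
    (G.1.map (eulerDeriv m)
        + G.1 * (Matrix.diagonal (fun j => eulerDeriv m ((q j).toLaurent m)) + Λ.map HahnSeries.C)
      = -((b.toMatrix fun j => C.nabla (b j)).map fun a => expandAtInfinity m (X * a)) * G.1) ∧
    ∀ p : ExpFactor, Θ (Quotient.mk galoisSetoid p) = Nat.card {j : Fin n // q j = p}

/-- A nonabelian Hodge diagram: the core diagram of the irregular class at infinity of an
algebraic connection on the affine line. -/
def Diagram.IsNonabelianHodge {N : Type*} (Γ : Diagram N) : Prop :=
  ∃ (C : AlgebraicConnection) (Θ : IrregularClass), C.HasIrregularClass Θ ∧ IsCoreDiagram Γ Θ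

end NonabelianHodge

end

/-! Choose a factor `q i` in each circle and take `r i = ram (q i)`. Write `R(S) = expRam S`, the
lcm of the denominators in `S`. Since `gcdWith r S = r / R(S)`, dividing by the two ramifications
turns `levelSum` into `∑ k * ramDrop S k` (`levelSum_eq`). By telescoping, these drops together with
`1 / R(S)` are weights of total mass 1. Up to the common shift by 1, a rescaled edge is therefore a
weighted mean of the common exponents and the fission exponent `x`. This is `fissionHeight (q i) x`,
equally `fissionHeight (q j) x`, and the rescaled loop at `i` is `fissionHeight (q i) 0`. Two facts
finish the proof: `fissionHeight q` is strictly increasing (`fissionHeight_strictMono`), so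
comparing edges at a common vertex amounts to comparing fission exponents; and fission exponents
satisfy the ultrametric inequality (`fissionExp_le_max`). The loop inequality is monotonicity
together with `0 ≤ x`. -/

namespace NonabelianHodge

/-- An exponent of an exponential factor. -/
abbrev Exponent := {k : ℚ // 0 < k}

/-! ### Sums over the levels of a finite set of exponents -/

/-- The least common multiple of the denominators of the elements of `S`. -/
noncomputable def expRam (S : Finset Exponent) : ℕ := S.lcm fun k => (k : ℚ).den

theorem expRam_pos (S : Finset Exponent) : 0 < expRam S := by
  refine Nat.pos_of_ne_zero fun h => ?_
  obtain ⟨k, -, hk⟩ := Finset.lcm_eq_zero_iff.1 h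
  exact (k : ℚ).den_nz hk

theorem expRam_mono {S T : Finset Exponent} (h : S ⊆ T) : expRam S ∣ expRam T :=
  Finset.lcm_mono h

theorem den_dvd_expRam {S : Finset Exponent} {k : Exponent} (hk : k ∈ S) :
    (k : ℚ).den ∣ expRam S :=
  Finset.dvd_lcm (f := fun k : Exponent => (k : ℚ).den) hk

theorem numer_mul_den {r : ℕ} {k : ℚ} (hk : 0 ≤ k) (h : k.den ∣ r) : (numer r k : ℚ) = k * r := by
  obtain ⟨c, rfl⟩ := h
  have h1 : k * ((k.den * c : ℕ) : ℚ) = ((k.num * c : ℤ) : ℚ) := by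
    push_cast
    rw [← mul_assoc, Rat.mul_den_eq_num]
  have h2 : 0 ≤ k.num * (c : ℤ) := mul_nonneg (Rat.num_nonneg.2 hk) (by positivity)
  rw [numer, h1, Rat.num_intCast]
  exact_mod_cast congrArg (Int.cast (R := ℚ)) (Int.toNat_of_nonneg h2)

/-- The numerator is `n * (k * m)`, so `n` divides it exactly when `k * m` is an integer. -/
theorem dvd_numer_iff {n m : ℕ} {k : ℚ} (hn : 0 < n) (hk : 0 ≤ k) (h : k.den ∣ n * m) :
    n ∣ numer (n * m) k ↔ k.den ∣ m := by
  have hn' : (n : ℚ) ≠ 0 := by positivity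
  have key := numer_mul_den hk h
  constructor
  · rintro ⟨c, hc⟩
    have h1 : k * m = c := by
      rw [hc] at key
      push_cast at key
      apply mul_left_cancel₀ hn'
      linarith
    have h2 : k.num * (m : ℤ) = c * k.den := by
      have : k * m * k.den = c * k.den := by rw [h1]
      rw [mul_right_comm, Rat.mul_den_eq_num] at this
      exact_mod_cast this
    have h3 : (k.den : ℤ) ∣ k.num * m := ⟨c, by rw [h2, mul_comm]⟩
    have h4 : k.den ∣ k.num.natAbs * m := by
      have := Int.natAbs_dvd_natAbs.2 h3
      simpa [Int.natAbs_mul] using this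
    exact (Nat.Coprime.dvd_of_dvd_mul_left k.reduced.symm h4)
  · intro hm
    have h1 := numer_mul_den hk hm
    refine ⟨numer m k, ?_⟩
    have : (numer (n * m) k : ℚ) = n * numer m k := by
      rw [key, h1]
      push_cast
      ring
    exact_mod_cast this

/-- A divisor `n` of `r` divides all the numerators iff every denominator divides `r / n`, that is,
iff `n` divides `r / expRam S`. -/
theorem gcdWith_mul_expRam {r : ℕ} (hr : 0 < r) {S : Finset Exponent}
    (h : expRam S ∣ r) : gcdWith r S * expRam S = r := by
  obtain ⟨c, hc⟩ := h
  have hc0 : 0 < c := Nat.pos_of_ne_zero (by rintro rfl; omega)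
  have hden : ∀ k ∈ S, (k : ℚ).den ∣ r := fun k hk =>
    (den_dvd_expRam hk).trans ⟨c, hc⟩
  suffices gcdWith r S = c by rw [this, hc, mul_comm]
  have key : ∀ n, n ∣ gcdWith r S ↔ n ∣ c := by
    intro n
    have h1 : n ∣ gcdWith r S ↔ n ∣ r ∧ ∀ k ∈ S, n ∣ numer r k := by
      rw [gcdWith, Nat.dvd_gcd_iff, Finset.dvd_gcd_iff]
    rw [h1]
    constructor
    · rintro ⟨⟨m, hm⟩, hk⟩
      have hn : 0 < n := Nat.pos_of_ne_zero (by rintro rfl; omega)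
      have hR : expRam S ∣ m := Finset.lcm_dvd fun k hkS =>
        (dvd_numer_iff hn k.2.le (hm ▸ hden k hkS)).1 (hm ▸ hk k hkS)
      obtain ⟨d, rfl⟩ := hR
      refine ⟨d, Nat.eq_of_mul_eq_mul_left (expRam_pos S) ?_⟩
      rw [← hc, hm]
      ring
    · rintro ⟨d, rfl⟩
      have hm : r = n * (expRam S * d) := by rw [hc]; ring
      have hn : 0 < n := Nat.pos_of_ne_zero (by rintro rfl; omega)
      refine ⟨⟨_, hm⟩, fun k hkS => ?_⟩
      have := hden k hkS
      rw [hm] at this ⊢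
      exact (dvd_numer_iff hn k.2.le this).2 ((den_dvd_expRam hkS).mul_right d)
  exact Nat.dvd_antisymm ((key _).1 dvd_rfl) ((key _).2 dvd_rfl)

/-- The drop at `k` of the inverse of the ramification of the part of `S` above `k`. -/
noncomputable def ramDrop (S : Finset Exponent) (k : Exponent) : ℚ :=
  (expRam (S.filter fun l => k < l) : ℚ)⁻¹ - (expRam (S.filter fun l => k ≤ l) : ℚ)⁻¹

theorem ramDrop_nonneg (S : Finset Exponent) (k : Exponent) :
    0 ≤ ramDrop S k := by
  have h1 := expRam_pos (S.filter fun l => k < l)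
  have h2 : expRam (S.filter fun l => k < l) ≤ expRam (S.filter fun l => k ≤ l) :=
    Nat.le_of_dvd (expRam_pos _)
      (expRam_mono (Finset.monotone_filter_right _ fun _ _ hl => le_of_lt hl))
  rw [ramDrop, sub_nonneg]
  gcongr

/-- The sum telescopes; adding a new minimum leaves the earlier drops unchanged. -/
theorem sum_ramDrop (S : Finset Exponent) :
    ∑ k ∈ S, ramDrop S k = 1 - (expRam S : ℚ)⁻¹ := by
  induction S using Finset.induction_on_min with
  | empty => simp [expRam]
  | insert a T ha ih =>
    have haT : a ∉ T := fun h => lt_irrefl a (ha a h)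
    have h1 : ∀ k ∈ T, ramDrop (insert a T) k = ramDrop T k := by
      intro k hk
      have hak := ha k hk
      rw [ramDrop, ramDrop, Finset.filter_insert, Finset.filter_insert, if_neg hak.not_gt,
        if_neg hak.not_ge]
    have h2 : ((insert a T).filter fun l => a < l) = T := by
      rw [Finset.filter_insert, if_neg (lt_irrefl a), Finset.filter_true_of_mem ha]
    have h3 : ((insert a T).filter fun l => a ≤ l) = insert a T :=
      Finset.filter_true_of_mem fun l hl => by
        rcases Finset.mem_insert.1 hl with rfl | hl
        · exact le_rfl
        · exact (ha l hl).le
    rw [Finset.sum_insert haT, Finset.sum_congr rfl h1, ih, ramDrop, h2, h3]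
    ring

/-- The mean over the Galois conjugates `q'` of a factor with exponents `S` of the larger of `x`
and the slope of `q - q'`, when `x` is below all the elements of `S`. -/
noncomputable def levelMean (S : Finset Exponent) (x : ℚ) : ℚ :=
  ∑ k ∈ S, (k : ℚ) * ramDrop S k + x * (expRam S : ℚ)⁻¹

/-- Passing to the right side keeps all weights, but raises the exponents `≤ y` and the value `x` to
`y`. Strictness comes from the positive weight `1 / expRam S` of `x`. -/
theorem levelMean_lt_filter (S : Finset Exponent) {x y : ℚ} (hxy : x < y) :
    levelMean S x < levelMean (S.filter fun k : Exponent => y < (k : ℚ)) y := by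
  have hdrop : ∀ k ∈ S.filter (fun k : Exponent => y < (k : ℚ)),
      ramDrop (S.filter fun k : Exponent => y < (k : ℚ)) k = ramDrop S k := by
    intro k hk
    have hyk : y < (k : ℚ) := (Finset.mem_filter.1 hk).2
    rw [ramDrop, ramDrop, Finset.filter_filter, Finset.filter_filter]
    have e1 : (S.filter fun l : Exponent => y < (l : ℚ) ∧ k < l) = S.filter fun l => k < l :=
      Finset.filter_congr fun l _ => ⟨fun h => h.2, fun h => ⟨hyk.trans h, h⟩⟩
    have e2 : (S.filter fun l : Exponent => y < (l : ℚ) ∧ k ≤ l) = S.filter fun l => k ≤ l :=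
      Finset.filter_congr fun l _ => ⟨fun h => h.2, fun h => ⟨hyk.trans_le h, h⟩⟩
    rw [e1, e2]
  have h1 := sum_ramDrop S
  have h2 := sum_ramDrop (S.filter fun k : Exponent => y < (k : ℚ))
  rw [Finset.sum_congr rfl hdrop] at h2
  rw [levelMean, levelMean,
    Finset.sum_congr rfl fun (k : Exponent) hk => congrArg ((k : ℚ) * ·) (hdrop k hk)]
  rw [← Finset.sum_filter_add_sum_filter_not S (fun k : Exponent => y < (k : ℚ))] at h1 ⊢
  have h3 : ∑ k ∈ S.filter (fun k : Exponent => ¬ y < (k : ℚ)), (k : ℚ) * ramDrop S k ≤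
      y * ∑ k ∈ S.filter (fun k : Exponent => ¬ y < (k : ℚ)), ramDrop S k := by
    rw [Finset.mul_sum]
    exact Finset.sum_le_sum fun k hk => mul_le_mul_of_nonneg_right
      (not_lt.1 (Finset.mem_filter.1 hk).2) (ramDrop_nonneg S k)
  have h4 : (0 : ℚ) < (expRam S : ℚ)⁻¹ := by
    have := expRam_pos S
    positivity
  have h5 := mul_lt_mul_of_pos_right hxy h4
  set A := ∑ k ∈ S.filter (fun k : Exponent => y < (k : ℚ)), ramDrop S k
  set B := ∑ k ∈ S.filter (fun k : Exponent => ¬ y < (k : ℚ)), ramDrop S k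
  -- Both systems of weights have mass 1, so the final weight on the right collects those of the
  -- discarded exponents.
  have h6 : (expRam (S.filter fun k : Exponent => y < (k : ℚ)) : ℚ)⁻¹ = B + (expRam S : ℚ)⁻¹ := by linarith
  rw [h6, mul_add]
  linarith

theorem levelMean_filter_strictMono (S : Finset Exponent) :
    StrictMono fun x : ℚ => levelMean (S.filter fun k : Exponent => x < (k : ℚ)) x := by
  intro x y hxy
  have h := levelMean_lt_filter (S.filter fun k : Exponent => x < (k : ℚ)) hxy
  rw [Finset.filter_filter] at h
  have hf : (S.filter fun k : Exponent => x < (k : ℚ) ∧ y < (k : ℚ)) =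
      S.filter fun k : Exponent => y < (k : ℚ) :=
    Finset.filter_congr fun k _ => ⟨fun h => h.2, fun h => ⟨hxy.trans h, h⟩⟩
  rwa [hf] at h

theorem filter_zero_lt (S : Finset Exponent) :
    (S.filter fun k : Exponent => (0 : ℚ) < (k : ℚ)) = S :=
  Finset.filter_true_of_mem fun k _ => k.2

theorem gcdWith_eq {r : ℕ} (hr : 0 < r) {S : Finset Exponent} (h : expRam S ∣ r) :
    (gcdWith r S : ℚ) = r * (expRam S : ℚ)⁻¹ := by
  have h1 := expRam_pos S
  rw [eq_mul_inv_iff_mul_eq₀ (by positivity)]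
  exact_mod_cast gcdWith_mul_expRam hr h

theorem levelSum_eq {r r' : ℕ} (hr' : 0 < r') {S : Finset Exponent} (h : expRam S ∣ r)
    (h' : expRam S ∣ r') :
    (levelSum r r' S : ℚ) = r * r' * ∑ k ∈ S, (k : ℚ) * ramDrop S k := by
  rw [levelSum, Finset.mul_sum]
  push_cast
  refine Finset.sum_congr rfl fun k hk => ?_
  rw [numer_mul_den k.2.le ((den_dvd_expRam hk).trans h),
    gcdWith_eq hr' ((expRam_mono (Finset.filter_subset _ _)).trans h'),
    gcdWith_eq hr' ((expRam_mono (Finset.filter_subset _ _)).trans h'), ramDrop]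
  ring

/-! ### The fission exponent -/

theorem ram_pos (q : ExpFactor) : 0 < ram q := expRam_pos _

theorem GaloisConj.filter {q q' : ExpFactor} (h : GaloisConj q q')
    (p : Exponent → Prop) [DecidablePred p] : GaloisConj (q.filter p) (q'.filter p) := by
  obtain ⟨n, hn⟩ := h
  refine ⟨n, fun l => ?_⟩
  by_cases hl : p l <;> simp [hl, hn l]

theorem GaloisConj.filter_of_imp {q q' : ExpFactor} {p₁ p₂ : Exponent → Prop}
    [DecidablePred p₁] [DecidablePred p₂] (h : GaloisConj (q.filter p₁) (q'.filter p₁))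
    (hp : ∀ k, p₂ k → p₁ k) : GaloisConj (q.filter p₂) (q'.filter p₂) := by
  have h1 := h.filter p₂
  have h2 : ∀ f : ExpFactor, (f.filter p₁).filter p₂ = f.filter p₂ := by
    intro f
    ext k
    by_cases hk : p₂ k
    · simp [hk, hp k hk]
    · simp [hk]
  rwa [h2, h2] at h1

theorem le_slope {q : ExpFactor} {k : Exponent} (hk : k ∈ q.support) : (k : ℚ) ≤ slope q :=
  NNRat.coe_le_coe.2 (Finset.le_sup (f := fun k : Exponent => (⟨(k : ℚ), k.2.le⟩ : ℚ≥0)) hk)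

theorem exists_eq_slope {q : ExpFactor} (h : 0 < (slope q : ℚ)) :
    ∃ k ∈ q.support, (k : ℚ) = slope q := by
  have hne : q.support.Nonempty := by
    by_contra hne
    rw [Finset.not_nonempty_iff_eq_empty] at hne
    have h0 : slope q = 0 := by
      unfold slope
      rw [hne]
      exact Finset.sup_empty
    rw [h0] at h
    exact lt_irrefl _ h
  obtain ⟨k, hk, h⟩ := Finset.exists_mem_eq_sup q.support hne
    fun k : Exponent => (⟨(k : ℚ), k.2.le⟩ : ℚ≥0)
  exact ⟨k, hk, (congrArg (NNRat.cast : ℚ≥0 → ℚ) h).symm⟩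

/-- Positivity of `x` covers `q = 0`, whose slope is `0`. -/
theorem slope_lt {q : ExpFactor} {x : ℚ} (hx : 0 < x) (h : ∀ k ∈ q.support, (k : ℚ) < x) :
    (slope q : ℚ) < x := by
  rcases (NNRat.coe_nonneg (slope q)).eq_or_lt with h0 | h0
  · rwa [← h0]
  · obtain ⟨k, hk, hk'⟩ := exists_eq_slope h0
    exact hk' ▸ h k hk

theorem den_slope_dvd {q p : ExpFactor} (h : p.support ⊆ q.support) :
    (slope p : ℚ).den ∣ ram q := by
  rcases (NNRat.coe_nonneg (slope p)).eq_or_lt with h0 | h0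
  · rw [← h0]
    exact one_dvd _
  · obtain ⟨k, hk, hk'⟩ := exists_eq_slope h0
    rw [← hk']
    exact den_dvd_expRam (h hk)

theorem cutoff_spec (q q' : ExpFactor) :
    0 < cutoff q q' ∧ GaloisConj (trunc (cutoff q q') q) (trunc (cutoff q q') q') := by
  have hL : 0 < Nat.lcm (ram q) (ram q') := Nat.lcm_pos (ram_pos q) (ram_pos q')
  set L := Nat.lcm (ram q) (ram q') with hLdef
  have hLq : (0 : ℚ) < (L : ℚ) := by exact_mod_cast hL
  -- Beyond both slopes the truncations vanish, so `sInf` is attained and is not the default value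
  -- for the empty set.
  have hne : {n : ℕ | 0 < n ∧ GaloisConj (trunc ((n : ℚ) / (L : ℕ)) q)
      (trunc ((n : ℚ) / (L : ℕ)) q')}.Nonempty := by
    obtain ⟨n, hn⟩ := exists_nat_gt (((slope q : ℚ) + slope q') * L)
    have hs := NNRat.coe_nonneg (slope q)
    have hs' := NNRat.coe_nonneg (slope q')
    have hn' : (slope q : ℚ) + slope q' < (n : ℚ) / L := by rwa [lt_div_iff₀ hLq]
    have hzero : ∀ p : ExpFactor, (slope p : ℚ) < (n : ℚ) / L → trunc ((n : ℚ) / L) p = 0 := by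
      intro p hp
      rw [trunc, Finsupp.filter_eq_zero_iff]
      intro k hk
      by_contra hpk
      exact absurd ((le_slope (Finsupp.mem_support_iff.2 hpk)).trans_lt hp) hk.not_gt
    refine ⟨n, ?_, ?_⟩
    · have h0 : (0 : ℚ) < n := lt_of_le_of_lt (by positivity) hn
      exact_mod_cast h0
    · rw [hzero q (by linarith), hzero q' (by linarith)]
      exact GaloisConj.refl 0
  have := Nat.sInf_mem hne
  refine ⟨?_, this.2⟩
  have h1 : (0 : ℚ) < (sInf {n : ℕ | 0 < n ∧ GaloisConj (trunc ((n : ℚ) / (L : ℕ)) q)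
      (trunc ((n : ℚ) / (L : ℕ)) q')} : ℕ) := by exact_mod_cast this.1
  exact div_pos h1 hLq

theorem cutoff_comm (q q' : ExpFactor) : cutoff q q' = cutoff q' q := by
  have key : ∀ k : ℚ, GaloisConj (trunc k q) (trunc k q') ↔ GaloisConj (trunc k q') (trunc k q) :=
    fun k => ⟨GaloisConj.symm, GaloisConj.symm⟩
  simp only [cutoff, Nat.lcm_comm (ram q) (ram q'), key]

theorem cutoff_le {q q' : ExpFactor} {x : ℚ} (hx : 0 < x)
    (hden : x.den ∣ Nat.lcm (ram q) (ram q')) (h : GaloisConj (trunc x q) (trunc x q')) :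
    cutoff q q' ≤ x := by
  have hL : 0 < Nat.lcm (ram q) (ram q') := Nat.lcm_pos (ram_pos q) (ram_pos q')
  have hLq : (0 : ℚ) < (Nat.lcm (ram q) (ram q') : ℕ) := by exact_mod_cast hL
  have hn := numer_mul_den hx.le hden
  set n := numer (Nat.lcm (ram q) (ram q')) x
  have hx' : (n : ℚ) / (Nat.lcm (ram q) (ram q') : ℕ) = x := by
    rw [hn, mul_div_cancel_right₀ _ hLq.ne']
  rw [← hx', cutoff]
  gcongr
  refine Nat.sInf_le ⟨?_, ?_⟩
  · have : (0 : ℚ) < n := by rw [hn]; positivity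
    exact_mod_cast this
  · rwa [hx']

theorem support_diffPart (q q' : ExpFactor) :
    (diffPart q q').support = q.support.filter fun k : Exponent => (k : ℚ) < cutoff q q' := by
  ext k
  by_cases hk : cutoff q q' ≤ (k : ℚ)
  · simp [diffPart, commonPart, trunc, hk]
  · simp [diffPart, commonPart, trunc, hk, not_le.1 hk]

theorem slope_diffPart_lt (q q' : ExpFactor) : (slope (diffPart q q') : ℚ) < cutoff q q' := by
  refine slope_lt (cutoff_spec q q').1 fun k hk => ?_
  rw [support_diffPart] at hk
  exact (Finset.mem_filter.1 hk).2

/-- The fission exponent of `⟨q⟩` and `⟨q'⟩`: the largest exponent of their different parts. -/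
noncomputable def fissionExp (q q' : ExpFactor) : ℚ :=
  max (slope (diffPart q q') : ℚ) (slope (diffPart q' q) : ℚ)

theorem fissionExp_comm (q q' : ExpFactor) : fissionExp q q' = fissionExp q' q := max_comm _ _

theorem fissionExp_nonneg (q q' : ExpFactor) : 0 ≤ fissionExp q q' :=
  (NNRat.coe_nonneg _).trans (le_max_left _ _)

theorem fissionExp_lt_cutoff (q q' : ExpFactor) : fissionExp q q' < cutoff q q' :=
  max_lt (slope_diffPart_lt q q') (cutoff_comm q q' ▸ slope_diffPart_lt q' q)

/-- An exponent below the cutoff belongs to the different part, hence is at most the fission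
exponent; the gap between the two contains no exponent of `q`. -/
theorem cutoff_le_iff {q q' : ExpFactor} {k : Exponent} (hk : k ∈ q.support) :
    cutoff q q' ≤ (k : ℚ) ↔ fissionExp q q' < k := by
  refine ⟨(fissionExp_lt_cutoff q q').trans_le, fun h => ?_⟩
  by_contra hlt
  refine absurd ((le_slope ?_).trans (le_max_left _ _)) h.not_ge
  rw [support_diffPart]
  exact Finset.mem_filter.2 ⟨hk, not_le.1 hlt⟩

theorem commonPart_eq_filter (q q' : ExpFactor) :
    commonPart q q' = q.filter fun k : Exponent => fissionExp q q' < (k : ℚ) := by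
  ext k
  by_cases hk : k ∈ q.support
  · simp [commonPart, trunc, Finsupp.filter_apply, cutoff_le_iff hk]
  · rw [Finsupp.notMem_support_iff] at hk
    simp [commonPart, trunc, Finsupp.filter_apply, hk]

theorem support_commonPart (q q' : ExpFactor) :
    (commonPart q q').support = q.support.filter fun k : Exponent => fissionExp q q' < (k : ℚ) := by
  rw [commonPart_eq_filter, Finsupp.support_filter]

theorem commonPart_conj (q q' : ExpFactor) : GaloisConj (commonPart q q') (commonPart q' q) := by
  have := (cutoff_spec q q').2
  rwa [commonPart, commonPart, ← cutoff_comm q q']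

theorem den_fissionExp_dvd (q q' : ExpFactor) :
    (fissionExp q q').den ∣ Nat.lcm (ram q) (ram q') := by
  have h : ∀ p p' : ExpFactor, (diffPart p p').support ⊆ p.support := fun p p' => by
    rw [support_diffPart]
    exact Finset.filter_subset _ _
  rcases max_choice (slope (diffPart q q') : ℚ) (slope (diffPart q' q) : ℚ) with h0 | h0
  · rw [fissionExp, h0]
    exact (den_slope_dvd (h q q')).trans (Nat.dvd_lcm_left _ _)
  · rw [fissionExp, h0]
    exact (den_slope_dvd (h q' q)).trans (Nat.dvd_lcm_right _ _)

/-- If conjugacy held above some `x` below the fission exponent, it would hold for the truncations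
at that exponent. As the exponent lies in the lattice defining the cutoff, this would contradict
minimality. -/
theorem fissionExp_le_iff {q q' : ExpFactor} {x : ℚ} (hx : 0 ≤ x) :
    fissionExp q q' ≤ x ↔
      GaloisConj (q.filter fun k : Exponent => x < (k : ℚ)) (q'.filter fun k : Exponent => x < (k : ℚ)) := by
  constructor
  · intro h
    have h1 := commonPart_conj q q'
    rw [commonPart_eq_filter, commonPart_eq_filter, fissionExp_comm q' q] at h1
    exact h1.filter_of_imp fun k hk => h.trans_lt hk
  · intro h
    by_contra! hlt
    have h1 : GaloisConj (trunc (fissionExp q q') q) (trunc (fissionExp q q') q') :=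
      h.filter_of_imp fun k hk => hlt.trans_le hk
    exact absurd (cutoff_le (hx.trans_lt hlt) (den_fissionExp_dvd q q') h1)
      (fissionExp_lt_cutoff q q').not_ge

/-- Transitivity of conjugacy for the parts above a common bound. -/
theorem fissionExp_le_max (p q q' : ExpFactor) :
    fissionExp p q' ≤ max (fissionExp p q) (fissionExp q q') := by
  have h0 : 0 ≤ max (fissionExp p q) (fissionExp q q') :=
    (fissionExp_nonneg p q).trans (le_max_left _ _)
  rw [fissionExp_le_iff h0]
  exact ((fissionExp_le_iff h0).1 (le_max_left _ _)).trans
    ((fissionExp_le_iff h0).1 (le_max_right _ _))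

/-! ### Rescaled multiplicities -/

/-- The rescaled edge multiplicity, up to a shift, of `⟨q⟩` with a circle of fission exponent
`x`. -/
noncomputable def fissionHeight (q : ExpFactor) (x : ℚ) : ℚ :=
  levelMean (q.support.filter fun k : Exponent => x < (k : ℚ)) x

theorem fissionHeight_strictMono (q : ExpFactor) : StrictMono (fissionHeight q) :=
  levelMean_filter_strictMono q.support

/-- The height sees only the exponents above the fission exponent, and conjugate common parts share
these. -/
theorem fissionHeight_fissionExp (q q' : ExpFactor) :
    fissionHeight q (fissionExp q q') = fissionHeight q' (fissionExp q q') := by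
  have h := (commonPart_conj q q').support_eq
  rw [support_commonPart, support_commonPart, fissionExp_comm q' q] at h
  rw [fissionHeight, fissionHeight, h]

theorem loopMultAux_eq (q : ExpFactor) :
    (loopMultAux q : ℚ) - 1 = (ram q : ℚ) ^ 2 * (fissionHeight q 0 - 1) := by
  have h := levelSum_eq (ram_pos q) (S := q.support) (r := ram q) dvd_rfl dvd_rfl
  -- At `x = 0` every exponent is kept and the final term of the mean vanishes.
  rw [fissionHeight, filter_zero_lt, levelMean, loopMultAux]
  push_cast
  rw [h]
  ring

theorem edgeFormula_eq {q q' : ExpFactor}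
    (h : slope (diffPart q' q) ≤ slope (diffPart q q')) :
    (edgeFormula q q' : ℚ) =
      (ram q : ℚ) * ram q' * (fissionHeight q (fissionExp q q') - 1) := by
  have hx : fissionExp q q' = slope (diffPart q q') := max_eq_left (NNRat.coe_le_coe.2 h)
  have h1 : expRam (commonPart q q').support ∣ ram q := by
    rw [support_commonPart]
    exact expRam_mono (Finset.filter_subset _ _)
  have h2 : expRam (commonPart q q').support ∣ ram q' := by
    rw [← (commonPart_conj q q').support_eq, support_commonPart]
    exact expRam_mono (Finset.filter_subset _ _)
  have h3 : (slope (diffPart q q') : ℚ).den ∣ ram q := den_slope_dvd (by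
    rw [support_diffPart]
    exact Finset.filter_subset _ _)
  rw [edgeFormula]
  push_cast
  rw [levelSum_eq (ram_pos q') h1 h2, gcdWith_eq (ram_pos q') h2,
    numer_mul_den (NNRat.coe_nonneg _) h3, fissionHeight, ← support_commonPart, levelMean, hx]
  ring

theorem edgeMultAux_eq (q q' : ExpFactor) :
    (edgeMultAux q q' : ℚ) =
      (ram q : ℚ) * ram q' * (fissionHeight q (fissionExp q q') - 1) := by
  rw [edgeMultAux]
  split_ifs with h
  · exact edgeFormula_eq h
  · rw [edgeFormula_eq (le_of_not_ge h), fissionExp_comm q' q, fissionHeight_fissionExp]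
    ring

end NonabelianHodge

open NonabelianHodge in
theorem rescaled_ram_conditions {N : Type*} (Γ : Diagram N) (q : N → ExpFactor)
    (hloop : ∀ i, Γ.B i i = loopMultAux (q i))
    (hedge : ∀ i j, i ≠ j → Γ.B i j = edgeMultAux (q i) (q j)) :
    UltrametricEdges (Γ.rescaled fun i => ⟨ram (q i), ram_pos (q i)⟩) ∧
      LoopEdgeInequality (Γ.rescaled fun i => ⟨ram (q i), ram_pos (q i)⟩) := by
  have hr : ∀ i, (ram (q i) : ℚ) ≠ 0 := fun i => by exact_mod_cast (ram_pos (q i)).ne'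
  have hE : ∀ i j, i ≠ j → Γ.rescaled (fun i => ⟨ram (q i), ram_pos (q i)⟩) i j =
      fissionHeight (q i) (fissionExp (q i) (q j)) - 1 := by
    intro i j hij
    have h1 := hr i
    have h2 := hr j
    simp only [Diagram.rescaled, if_neg hij]
    rw [hedge i j hij, edgeMultAux_eq]
    simp only [PNat.mk_coe]
    field_simp
  have hE' : ∀ i j, i ≠ j → Γ.rescaled (fun i => ⟨ram (q i), ram_pos (q i)⟩) i j =
      fissionHeight (q j) (fissionExp (q i) (q j)) - 1 := by
    intro i j hij
    rw [hE i j hij, fissionHeight_fissionExp]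
  have hL : ∀ i, Γ.rescaled (fun i => ⟨ram (q i), ram_pos (q i)⟩) i i =
      fissionHeight (q i) 0 - 1 := by
    intro i
    have h1 := hr i
    simp only [Diagram.rescaled, if_true]
    rw [hloop i, loopMultAux_eq]
    simp only [PNat.mk_coe]
    field_simp
  constructor
  · intro i j k hij hik hjk h1 h2
    -- The first inequality is read with the height at `i`, the second with the height at `k`: only
    -- edges sharing a vertex are measured by the same increasing function.
    rw [hE i j hij, hE i k hik, sub_le_sub_iff_right,
      (fissionHeight_strictMono _).le_iff_le] at h1
    rw [hE' i k hik, hE' j k hjk] at h2 ⊢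
    rw [sub_le_sub_iff_right, (fissionHeight_strictMono _).le_iff_le] at h2
    -- The ultrametric inequality through `i` bounds the `j`–`k` exponent by the `i`–`k` one, the
    -- converse of `h2`.
    have h3 := fissionExp_le_max (q j) (q i) (q k)
    rw [fissionExp_comm (q j) (q i), max_eq_right h1] at h3
    rw [le_antisymm h2 h3]
  · intro i j hij
    rw [hL i, hE i j hij, sub_le_sub_iff_right, (fissionHeight_strictMono _).le_iff_le]
    exact fissionExp_nonneg _ _

theorem corollary1p9 {N : Type*} [Finite N] (Γ : NonabelianHodge.Diagram N)
    (hΓ : Γ.IsNonabelianHodge) :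
    ∃ r : N → ℕ+,
      NonabelianHodge.UltrametricEdges (Γ.rescaled r) ∧
      NonabelianHodge.LoopEdgeInequality (Γ.rescaled r) := by
  obtain ⟨_, Θ, -, I, hloop, hedge⟩ := hΓ
  -- Once each circle is written as the class of its chosen representative, the lifted
  -- multiplicities unfold by `rfl`.
  have hout : ∀ i, Quotient.mk NonabelianHodge.galoisSetoid (Quotient.out (I i).1) = (I i).1 :=
    fun i => Quotient.out_eq _
  refine ⟨_, rescaled_ram_conditions Γ (fun i => Quotient.out (I i).1) (fun i => ?_)
    fun i j hij => ?_⟩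
  · rw [hloop i]
    conv_lhs => rw [← hout i]
    rfl
  · rw [hedge i j hij]
    conv_lhs => rw [← hout i, ← hout j]
    rfl
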